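/- A twisted unital discrete $C^*$-dynamical system $\Sigma=(A,G,\alpha,\sigma)$ consists of a unital $C^*$-algebra $A$, a discrete group $G$ with identity $e$, a map $\alpha\colon G\to\mathrm{Aut}(A)$ into the $*$-automorphisms of $A$, and a map $\sigma\colon G\times G\to\mathcal U(A)$ into the unitaries of $A$ such that, for all $g,h,k\in G$, $\alpha_g\alpha_h=\mathrm{Ad}(\sigma(g,h))\,\alpha_{gh}$, $\ \sigma(g,h)\sigma(gh,k)=\alpha_g(\sigma(h,k))\sigma(g,hk)$ and $\sigma(g,e)=\sigma(e,g)=1_A$. A map $T\colon G\times A\to A$, $(g,a)\mapsto T_g(a)$, linear in $a$, is called $\Sigma$-positive definite if for all $n\in\mathbb N$, $g_1,\dots,g_n\in G$ and $a_1,\dots,a_n\in A$ the matrix $$\Big[\alpha_{g_i}\Big(T_{g_i^{-1}g_j}\big(\alpha_{g_i}^{-1}(a_i^*a_j\,\sigma(g_i,g_i^{-1}g_j)^*)\big)\Big)\,\sigma(g_i,g_i^{-1}g_j)\Big]_{i,j}$$ is positive in the $C^*$-algebra $M_n(A)$. The system $\Sigma$ is called amenable if there is a net $(T^\nu)$ of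 $\Sigma$-positive definite maps such that each $T^\nu$ is finitely supported (the set $\{g\in G: T^\nu_g\neq 0\}$ is finite), $\sup_\nu\sup_{g\in G}\|T^\nu_g\|<\infty$, and $\lim_\nu\|T^\nu_g(a)-a\|=0$ for all $g\in G$ and $a\in A$. Let $\Sigma=(A,G,\alpha,\sigma)$ and $\Theta=(B,G,\beta,\theta)$ be two such systems over the same group $G$. Let $Z$ be an $A$-$B$ imprimitivity bimodule: $Z$ is a full right Hilbert $B$-module, with inner product $\langle\cdot,\cdot\rangle_B$ linear in the second variable, on which $A$ acts from the left through a unital $*$-homomorphism into the adjointable operators; $Z$ is also a full left Hilbert $A$-module, with inner product ${}_A\langle\cdot,\cdot\rangle$ linear in the first variable, on which $B$ acts from the right by operators that are adjointable for ${}_A\langle\cdot,\cdot\rangle$, with ${}_A\langle z\cdot b,z'\rangle={}_A\langle z,z'\cdot b^*\rangle$; and ${}_A\langle z,z'\rangle\cdot z''=z\cdot\langle z',z''\rangle_B$ for all $z,z',z''\in Z$. Let $\delta$ be a $(\Sigma,\Theta)$-compatible action of $G$ on $Z$, that is, a map from $G$ into the invertible bounded $\mathbb C$-linear maps from $Z$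 onto itself such that, for all $g,h\in G$, $a\in A$, $b\in B$, $z,\zeta\in Z$, $$\delta(g)(a\cdot z)=\alpha_g(a)\cdot\delta(g)z,\qquad \delta(g)(z\cdot b)=(\delta(g)z)\cdot\beta_g(b),$$ $$\delta(g)\delta(h)z=\sigma(g,h)\cdot(\delta(gh)z)\cdot\theta(g,h)^*,\qquad \langle\delta(g)z,\delta(g)\zeta\rangle_B=\beta_g(\langle z,\zeta\rangle_B).$$ (When such $Z$ and $\delta$ exist, $\Sigma$ and $\Theta$ are called Morita equivalent.) Theorem. If $\Sigma$ is amenable, then $\Theta$ is amenable. -/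

import Mathlib

open scoped RightActions
open Filter Topology

/-- A twisted unital discrete C⋆-dynamical system `(A, G, α, σ)`: a unital C⋆-algebra `A`, a group
`G` (regarded as discrete), a map `α` from `G` to the ⋆-automorphisms of `A`, and a normalized
2-cocycle `σ` for `α` with values in the unitary group of `A`. -/
structure TwistedSystem (A G : Type*) [CStarAlgebra A] [Group G] where
  /-- the map `g ↦ α_g` -/
  α : G → (A ≃⋆ₐ[ℂ] A)
  /-- the 2-cocycle -/
  σ : G → G → unitary A
  /-- `α_g α_h = Ad(σ(g,h)) α_{gh}` -/
  α_comp : ∀ (g h : G) (a : A), α g (α h a) = σ g h * α (g * h) a * star (σ g h : A)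
  /-- `σ(g,h) σ(gh,k) = α_g(σ(h,k)) σ(g,hk)` -/
  σ_cocycle : ∀ g h k : G,
    (σ g h * σ (g * h) k : A) = α g (σ h k : A) * (σ g (h * k) : A)
  σ_one_right : ∀ g : G, σ g 1 = 1
  σ_one_left : ∀ g : G, σ 1 g = 1

namespace TwistedSystem

/-- Positive definiteness of `T : G × A → A`, linear in the second variable, with respect to the
system `S`: for all finite families `g_i`, `a_i`, the matrix with entries
`α_{g_i}(T_{g_i⁻¹ g_j}(α_{g_i}⁻¹(a_i⋆ a_j σ(g_i, g_i⁻¹ g_j)⋆))) σ(g_i, g_i⁻¹ g_j)` is a positive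
element of the C⋆-algebra `M_n(A)`. -/
def IsPositiveDefinite {A G : Type*} [CStarAlgebra A] [PartialOrder A] [StarOrderedRing A]
    [Group G] (S : TwistedSystem A G) (T : G → (A →ₗ[ℂ] A)) : Prop :=
  ∀ (n : ℕ) (g : Fin n → G) (a : Fin n → A),
    0 ≤ CStarMatrix.ofMatrix (Matrix.of fun i j : Fin n =>
      S.α (g i) (T ((g i)⁻¹ * g j)
        ((S.α (g i)).symm (star (a i) * a j * star (S.σ (g i) ((g i)⁻¹ * g j) : A))))
        * (S.σ (g i) ((g i)⁻¹ * g j) : A))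

/-- Amenability of the system `S`: there is a net `(T_i)` of `S`-positive definite maps which are
finitely supported, uniformly bounded (`sup_i sup_g ‖T_{i,g}‖ < ∞`, operator norms of linear maps
`A → A`), and converge pointwise in norm to the identity: `‖T_{i,g}(a) - a‖ → 0` for all `g`, `a`.
The index sets of nets may be taken in the universe of `G × A`, since a net in a larger universe
can be replaced by one indexed by pairs of a finite subset of `G × A` and a natural number. -/
def IsAmenable.{u, w} {A : Type u} {G : Type w} [CStarAlgebra A] [PartialOrder A]
    [StarOrderedRing A] [Group G] (S : TwistedSystem A G) : Prop :=
  ∃ (I : Type (max u w)) (_ : Preorder I) (_ : IsDirectedOrder I) (_ : Nonempty I)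
    (T : I → G → (A →ₗ[ℂ] A)),
    (∀ i, S.IsPositiveDefinite (T i)) ∧
    (∀ i, {g : G | T i g ≠ 0}.Finite) ∧
    (∃ C : ℝ, ∀ (i : I) (g : G) (a : A), ‖T i g a‖ ≤ C * ‖a‖) ∧
    (∀ (g : G) (a : A), Tendsto (fun i => ‖T i g a - a‖) atTop (𝓝 0))

end TwistedSystem

/-- A right Hilbert `A`-`B` bimodule structure on the Banach space `Z`, which carries a left action
of `A` and a right action `z <• b` of `B` (that is, a module structure over `Bᵐᵒᵖ`), both unital
and compatible with the complex scalars: a `B`-valued inner product, linear in the second variable,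
which induces the (complete) norm of `Z`, and such that `A` acts by adjointable operators, `a⋆`
acting as the adjoint of `a`. That is, `a ↦ (z ↦ a • z)` is a unital ⋆-homomorphism from `A` to
the adjointable operators on the right Hilbert `B`-module `Z`.
(Mathlib's `CStarModule` is a left module, `⟪x, a • y⟫ = a * ⟪x, y⟫`, so it is not used here.) -/
structure RightHilbertBimodule (A B Z : Type*) [CStarAlgebra A]
    [CStarAlgebra B] [PartialOrder B] [StarOrderedRing B]
    [NormedAddCommGroup Z] [NormedSpace ℂ Z] [CompleteSpace Z]
    [Module A Z] [IsScalarTower ℂ A Z] [Module Bᵐᵒᵖ Z] [IsScalarTower ℂ Bᵐᵒᵖ Z] where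
  /-- the inner product `⟨x, y⟩_B` -/
  innerR : Z → Z → B
  innerR_add_right : ∀ x y z, innerR x (y + z) = innerR x y + innerR x z
  innerR_smul_right : ∀ (c : ℂ) (x y : Z), innerR x (c • y) = c • innerR x y
  innerR_act_right : ∀ (x y : Z) (b : B), innerR x (y <• b) = innerR x y * b
  star_innerR : ∀ x y, star (innerR x y) = innerR y x
  innerR_self_nonneg : ∀ x, 0 ≤ innerR x x
  norm_eq_sqrt_innerR : ∀ x, ‖x‖ = √‖innerR x x‖
  innerR_act_left : ∀ (a : A) (x y : Z), innerR (a • x) y = innerR x (star a • y)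

/-- An `A`-`B` imprimitivity bimodule: a full right Hilbert `A`-`B` bimodule which is also a full
left Hilbert `A`-`B` bimodule, with `A`-valued inner product linear in the first variable, such that
`_A⟨x, y⟩ • z = x <• ⟨y, z⟩_B`. The norms induced by the two inner products then coincide, so that
`Z`, being complete for the norm of the right inner product, is complete for that of the left one. -/
structure ImprimitivityBimodule (A B Z : Type*)
    [CStarAlgebra A] [PartialOrder A] [StarOrderedRing A]
    [CStarAlgebra B] [PartialOrder B] [StarOrderedRing B]
    [NormedAddCommGroup Z] [NormedSpace ℂ Z] [CompleteSpace Z]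
    [Module A Z] [IsScalarTower ℂ A Z] [Module Bᵐᵒᵖ Z] [IsScalarTower ℂ Bᵐᵒᵖ Z]
    extends RightHilbertBimodule A B Z where
  /-- the inner product `_A⟨x, y⟩` -/
  innerL : Z → Z → A
  innerL_add_left : ∀ x y z, innerL (x + y) z = innerL x z + innerL y z
  innerL_smul_left : ∀ (c : ℂ) (x y : Z), innerL (c • x) y = c • innerL x y
  innerL_act_left : ∀ (a : A) (x y : Z), innerL (a • x) y = a * innerL x y
  star_innerL : ∀ x y, star (innerL x y) = innerL y x
  innerL_self_nonneg : ∀ x, 0 ≤ innerL x x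
  eq_zero_of_innerL_self : ∀ x, innerL x x = 0 → x = 0
  innerL_act_right : ∀ (x y : Z) (b : B), innerL (x <• b) y = innerL x (y <• star b)
  /-- fullness of the right Hilbert module -/
  fullR : Dense (Submodule.span ℂ (Set.range fun p : Z × Z => innerR p.1 p.2) : Set B)
  /-- fullness of the left Hilbert module -/
  fullL : Dense (Submodule.span ℂ (Set.range fun p : Z × Z => innerL p.1 p.2) : Set A)
  innerL_smul_eq : ∀ x y z : Z, innerL x y • z = x <• innerR y z

/-- An `(S, T)`-compatible action `δ` of `G` on the right Hilbert `A`-`B` bimodule `E`, where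
`S = (A, G, α, σ)` and `T = (B, G, β, θ)`: a map from `G` to the invertible bounded complex linear
maps of `Z` onto itself. -/
structure CompatibleAction {A B G Z : Type*} [CStarAlgebra A]
    [CStarAlgebra B] [PartialOrder B] [StarOrderedRing B] [Group G]
    [NormedAddCommGroup Z] [NormedSpace ℂ Z] [CompleteSpace Z]
    [Module A Z] [IsScalarTower ℂ A Z] [Module Bᵐᵒᵖ Z] [IsScalarTower ℂ Bᵐᵒᵖ Z]
    (S : TwistedSystem A G) (T : TwistedSystem B G) (E : RightHilbertBimodule A B Z) where
  /-- the map `g ↦ δ(g)` -/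
  δ : G → (Z ≃L[ℂ] Z)
  δ_act_left : ∀ (g : G) (a : A) (z : Z), δ g (a • z) = S.α g a • δ g z
  δ_act_right : ∀ (g : G) (z : Z) (b : B), δ g (z <• b) = δ g z <• T.α g b
  δ_comp : ∀ (g h : G) (z : Z),
    δ g (δ h z) = ((S.σ g h : A) • δ (g * h) z) <• star (T.σ g h : B)
  innerR_δ : ∀ (g : G) (x y : Z), E.innerR (δ g x) (δ g y) = T.α g (E.innerR x y)

/-! Fullness and unitality of `B` give vectors `x_i` in `Z` with `∑ ⟨x_i, x_i⟩_B = 1`. Such a frame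
carries `φ` on `A` to `φ'_g(b) = ∑_{i,j} ⟨x_i, φ_g(_A⟨x_i b, δ(g)x_j⟩) δ(g)x_j⟩_B` (`transport`).
Finite support and uniform bounds are inherited, and for `φ_g = id` the sum collapses to `b`, so
convergence to the identity passes over. For positivity, inserting the frame once more writes the
matrix of `φ'` as a sum over `k` of compressions, along the vectors `δ(g_p)x_i`, of positive
matrices of `φ`; the cocycles match by `α_coeff`, and `compression_nonneg` concludes. -/

/-! ### Positive forms with dense span and normalised finite families. -/

section Form

variable {C Z : Type*} [CStarAlgebra C] [PartialOrder C]
  [AddCommGroup Z] [Module ℂ Z]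

/-- A `C`-valued positive hermitian form on a complex vector space. -/
structure PositiveForm (f : Z → Z → C) : Prop where
  add_right : ∀ x y z, f x (y + z) = f x y + f x z
  smul_right : ∀ (c : ℂ) (x y : Z), f x (c • y) = c • f x y
  star_eq : ∀ x y, star (f x y) = f y x
  self_nonneg : ∀ x, 0 ≤ f x x

namespace PositiveForm

variable {f : Z → Z → C}

theorem add_left (hf : PositiveForm f) (x y z : Z) : f (x + y) z = f x z + f y z := by
  rw [← hf.star_eq, hf.add_right, star_add, hf.star_eq, hf.star_eq]

/-- The form as an additive map in its second variable. -/
def right (hf : PositiveForm f) (x : Z) : Z →+ C := AddMonoidHom.mk' (f x) (hf.add_right x)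

/-- The form as an additive map in its first variable. -/
def left (hf : PositiveForm f) (y : Z) : Z →+ C :=
  AddMonoidHom.mk' (fun x => f x y) (fun x x' => hf.add_left x x' y)

theorem sum_right (hf : PositiveForm f) {ι : Type*} (s : Finset ι) (x : Z) (y : ι → Z) :
    f x (∑ i ∈ s, y i) = ∑ i ∈ s, f x (y i) :=
  map_sum (hf.right x) y s

theorem sum_left (hf : PositiveForm f) {ι : Type*} (s : Finset ι) (x : ι → Z) (y : Z) :
    f (∑ i ∈ s, x i) y = ∑ i ∈ s, f (x i) y :=
  map_sum (hf.left y) x s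

theorem sub_right (hf : PositiveForm f) (x y z : Z) : f x (y - z) = f x y - f x z :=
  map_sub (hf.right x) y z

theorem sub_left (hf : PositiveForm f) (x y z : Z) : f (x - y) z = f x z - f y z :=
  map_sub (hf.left z) x y

variable [StarOrderedRing C]

theorem add_swap_le (hf : PositiveForm f) (x y : Z) : f x y + f y x ≤ f x x + f y y := by
  have h := hf.self_nonneg (x - y)
  rw [hf.sub_right, hf.sub_left, hf.sub_left] at h
  rw [← sub_nonneg]
  convert h using 1
  abel

/-- The real part of an element of the span of the values of a positive form is dominated by a sum
of values on the diagonal. -/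
theorem add_star_le_sum (hf : PositiveForm f) {c : C}
    (hc : c ∈ Submodule.span ℂ (Set.range fun p : Z × Z => f p.1 p.2)) :
    ∀ t : ℂ, ∃ (n : ℕ) (z : Fin n → Z), t • c + star (t • c) ≤ ∑ i, f (z i) (z i) := by
  -- Quantifying over all `t` absorbs the scalar case of the induction.
  induction hc using Submodule.span_induction with
  | mem c hc =>
    obtain ⟨⟨x, y⟩, rfl⟩ := hc
    refine fun t => ⟨2, ![x, t • y], ?_⟩
    simpa [Fin.sum_univ_two, ← hf.smul_right, hf.star_eq] using hf.add_swap_le x (t • y)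
  | zero => exact fun t => ⟨0, Fin.elim0, by simp⟩
  | add c d _ _ hc hd =>
    intro t
    obtain ⟨m, x, hx⟩ := hc t
    obtain ⟨n, y, hy⟩ := hd t
    refine ⟨m + n, Fin.append x y, ?_⟩
    simp only [Fin.sum_univ_add, Fin.append_left, Fin.append_right, smul_add, star_add]
    calc _ = (t • c + star (t • c)) + (t • d + star (t • d)) := by abel
      _ ≤ _ := add_le_add hx hy
  | smul s c _ hc =>
    intro t
    simpa [smul_smul] using hc (t * s)

/-- If the values of a positive form span a dense subspace, then there are finitely many vectors
`z_i` and a self-adjoint `d` such that `d (∑ f(z_i, z_i)) d = 1`. -/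
theorem exists_conjugate_sum_eq_one (hf : PositiveForm f)
    (hd : Dense (Submodule.span ℂ (Set.range fun p : Z × Z => f p.1 p.2) : Set C)) :
    ∃ (n : ℕ) (z : Fin n → Z) (d : C), star d = d ∧ d * (∑ i, f (z i) (z i)) * d = 1 := by
  -- Any radius up to `1/2` would do: it gives `2 - (c + c⋆) ≤ 1`, hence `1 ≤ c + c⋆ ≤ b`, and `d =
  -- b^(-1/2)` exists.
  obtain ⟨c, hc, hcd⟩ := Metric.dense_iff.1 hd 1 (1 / 4) (by norm_num)
  obtain ⟨n, z, hz⟩ := hf.add_star_le_sum hcd 1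
  rw [one_smul] at hz
  set b := ∑ i, f (z i) (z i)
  have hsa : IsSelfAdjoint ((1 - c) + star (1 - c)) := IsSelfAdjoint.add_star_self _
  have hn : ‖(1 - c) + star (1 - c)‖ ≤ 1 := by
    rw [Metric.mem_ball, dist_comm, dist_eq_norm] at hc
    calc _ ≤ ‖1 - c‖ + ‖star (1 - c)‖ := norm_add_le _ _
      _ ≤ 1 := by rw [norm_star]; linarith
  have h1 : (1 - c) + star (1 - c) ≤ 1 :=
    hsa.le_algebraMap_norm_self.trans <| by
      simpa using algebraMap_mono C hn
  have hb : 1 ≤ b := by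
    refine le_trans ?_ hz
    rw [← sub_nonneg] at h1 ⊢
    convert h1 using 1
    simp only [star_sub, star_one]
    abel
  have hpos : IsStrictlyPositive b := isStrictlyPositive_one.of_le hb
  refine ⟨n, z, b ^ (-(1 / 2) : ℝ), ?_, CFC.conjugate_rpow_neg_one_half b hpos⟩
  exact (IsSelfAdjoint.of_nonneg CFC.rpow_nonneg).star_eq

end PositiveForm

end Form

/-! ### Frames and norm estimates in an imprimitivity bimodule. -/

namespace ImprimitivityBimodule

variable {A B Z : Type*}
    [CStarAlgebra A] [PartialOrder A] [StarOrderedRing A]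
    [CStarAlgebra B] [PartialOrder B] [StarOrderedRing B]
    [NormedAddCommGroup Z] [NormedSpace ℂ Z] [CompleteSpace Z]
    [Module A Z] [IsScalarTower ℂ A Z] [Module Bᵐᵒᵖ Z] [IsScalarTower ℂ Bᵐᵒᵖ Z]
    (E : ImprimitivityBimodule A B Z)

theorem positiveForm_innerR : PositiveForm E.innerR where
  add_right := E.innerR_add_right
  smul_right := E.innerR_smul_right
  star_eq := E.star_innerR
  self_nonneg := E.innerR_self_nonneg

theorem positiveForm_innerL : PositiveForm fun x y => E.innerL y x where
  add_right x y z := E.innerL_add_left y z x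
  smul_right c x y := E.innerL_smul_left c y x
  star_eq x y := E.star_innerL y x
  self_nonneg := E.innerL_self_nonneg

theorem innerR_smul_left_eq (a : A) (x y : Z) : E.innerR x (a • y) = E.innerR (star a • x) y := by
  rw [E.innerR_act_left, star_star]

theorem innerR_act_right_left (x y : Z) (b : B) :
    E.innerR (x <• b) y = star b * E.innerR x y := by
  rw [← E.star_innerR, E.innerR_act_right, star_mul, E.star_innerR]

theorem innerL_act_left_right (x y : Z) (a : A) :
    E.innerL x (a • y) = E.innerL x y * star a := by
  rw [← E.star_innerL, E.innerL_act_left, star_mul, E.star_innerL]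

include E in
theorem ext_innerR {x y : Z} (h : ∀ z, E.innerR z x = E.innerR z y) : x = y := by
  have h0 : E.innerR (x - y) (x - y) = 0 := by
    rw [E.positiveForm_innerR.sub_right, h, sub_self]
  rw [← sub_eq_zero, ← norm_eq_zero, E.norm_eq_sqrt_innerR, h0, norm_zero, Real.sqrt_zero]

-- Commutation of the two actions is not an axiom: adjointable operators are automatically
-- `B`-linear.
include E in
theorem smul_act_comm (a : A) (z : Z) (b : B) : (a • z) <• b = a • (z <• b) :=
  E.ext_innerR fun w => by
    rw [E.innerR_act_right, innerR_smul_left_eq, innerR_smul_left_eq, E.innerR_act_right]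

theorem exists_sum_innerR_eq_one : ∃ (n : ℕ) (z : Fin n → Z), ∑ i, E.innerR (z i) (z i) = 1 := by
  obtain ⟨n, z, d, hd, h⟩ := E.positiveForm_innerR.exists_conjugate_sum_eq_one E.fullR
  refine ⟨n, fun i => z i <• d, ?_⟩
  rw [← h, Finset.mul_sum, Finset.sum_mul]
  simp only [E.innerR_act_right, E.innerR_act_right_left, hd]

theorem exists_sum_innerL_eq_one : ∃ (n : ℕ) (z : Fin n → Z), ∑ i, E.innerL (z i) (z i) = 1 := by
  have hfull := E.fullL
  have hr : (Set.range fun p : Z × Z => E.innerL p.2 p.1) =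
      Set.range fun p : Z × Z => E.innerL p.1 p.2 := by
    ext a
    exact ⟨fun ⟨p, hp⟩ => ⟨p.swap, hp⟩, fun ⟨p, hp⟩ => ⟨p.swap, hp⟩⟩
  rw [← hr] at hfull
  obtain ⟨n, z, d, hd, h⟩ := E.positiveForm_innerL.exists_conjugate_sum_eq_one hfull
  refine ⟨n, fun i => d • z i, ?_⟩
  rw [← h, Finset.mul_sum, Finset.sum_mul]
  simp only [E.innerL_act_left, E.innerL_act_left_right, hd, mul_assoc]

include E in
theorem eq_of_smul_eq {a a' : A} (h : ∀ z : Z, a • z = a' • z) : a = a' := by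
  obtain ⟨n, z, hz⟩ := E.exists_sum_innerL_eq_one
  rw [← mul_one a, ← mul_one a', ← hz, Finset.mul_sum, Finset.mul_sum]
  simp only [← E.innerL_act_left, h]

theorem innerR_smul_self_nonneg {a : A} (ha : 0 ≤ a) (z : Z) :
    0 ≤ E.innerR z (a • z) := by
  obtain ⟨c, rfl⟩ := CStarAlgebra.nonneg_iff_eq_star_mul_self.1 ha
  rw [mul_smul, ← E.innerR_act_left]
  exact E.innerR_self_nonneg _

theorem innerL_act_self_nonneg {b : B} (hb : 0 ≤ b) (z : Z) :
    0 ≤ E.innerL (z <• b) z := by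
  obtain ⟨c, rfl⟩ := CStarAlgebra.nonneg_iff_eq_mul_star_self.1 hb
  rw [MulOpposite.op_mul, mul_smul, E.innerL_act_right, star_star]
  exact E.innerL_self_nonneg _

theorem norm_innerR_smul_self_le {a : A} (ha : 0 ≤ a) (z : Z) :
    ‖E.innerR z (a • z)‖ ≤ ‖a‖ * ‖E.innerR z z‖ := by
  have h : 0 ≤ E.innerR z ((algebraMap ℝ A ‖a‖ - a) • z) :=
    E.innerR_smul_self_nonneg (sub_nonneg.2 (IsSelfAdjoint.of_nonneg ha).le_algebraMap_norm_self) z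
  have hs : (algebraMap ℝ A ‖a‖) • z = (‖a‖ : ℂ) • z := by
    rw [← algebraMap_smul A (‖a‖ : ℂ) z]
    rfl
  rw [sub_smul, E.positiveForm_innerR.sub_right, sub_nonneg, hs, E.innerR_smul_right] at h
  refine (CStarAlgebra.norm_le_norm_of_nonneg_of_le (E.innerR_smul_self_nonneg ha z) h).trans ?_
  rw [norm_smul]
  simp

theorem norm_innerL_act_self_le {b : B} (hb : 0 ≤ b) (z : Z) :
    ‖E.innerL (z <• b) z‖ ≤ ‖b‖ * ‖E.innerL z z‖ := by
  have h : 0 ≤ E.innerL (z <• (algebraMap ℝ B ‖b‖ - b)) z :=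
    E.innerL_act_self_nonneg (sub_nonneg.2 (IsSelfAdjoint.of_nonneg hb).le_algebraMap_norm_self) z
  have hs : z <• (algebraMap ℝ B ‖b‖) = (‖b‖ : ℂ) • z := by
    rw [← algebraMap_smul Bᵐᵒᵖ (‖b‖ : ℂ) z]
    rfl
  rw [MulOpposite.op_sub, sub_smul, E.positiveForm_innerL.sub_right z, sub_nonneg, hs,
    E.innerL_smul_left] at h
  refine (CStarAlgebra.norm_le_norm_of_nonneg_of_le (E.innerL_act_self_nonneg hb z) h).trans ?_
  rw [norm_smul]
  simp

/-- Cauchy–Schwarz, from `⟨x,y⟩_B ⟨y,x⟩_B = ⟨x, _A⟨y,y⟩ x⟩_B`. Since it mixes both inner products,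
`x = y` lets their norms be compared. -/
theorem norm_innerR_mul_self_le (x y : Z) :
    ‖E.innerR x y‖ * ‖E.innerR x y‖ ≤ ‖E.innerL y y‖ * ‖E.innerR x x‖ := by
  rw [← CStarRing.norm_self_mul_star, E.star_innerR, ← E.innerR_act_right, ← E.innerL_smul_eq]
  exact E.norm_innerR_smul_self_le (E.innerL_self_nonneg y) x

theorem norm_innerL_mul_self_le (x y : Z) :
    ‖E.innerL x y‖ * ‖E.innerL x y‖ ≤ ‖E.innerR y y‖ * ‖E.innerL x x‖ := by
  rw [← CStarRing.norm_self_mul_star, E.star_innerL, ← E.innerL_act_left, E.innerL_smul_eq]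
  exact E.norm_innerL_act_self_le (E.innerR_self_nonneg y) x

theorem norm_innerR_self (x : Z) : ‖E.innerR x x‖ = ‖x‖ * ‖x‖ := by
  rw [E.norm_eq_sqrt_innerR, Real.mul_self_sqrt (norm_nonneg _)]

/-- The norms induced by the two inner products coincide. -/
theorem norm_innerL_self (x : Z) : ‖E.innerL x x‖ = ‖x‖ * ‖x‖ := by
  rw [← E.norm_innerR_self]
  have h1 := E.norm_innerR_mul_self_le x x
  have h2 := E.norm_innerL_mul_self_le x x
  have p := norm_nonneg (E.innerR x x)
  have q := norm_nonneg (E.innerL x x)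
  -- The two bounds add up to `(p - q)² ≤ 0` for the two norms `p`, `q`.
  nlinarith

theorem norm_innerR_le (x y : Z) : ‖E.innerR x y‖ ≤ ‖x‖ * ‖y‖ := by
  refine nonneg_le_nonneg_of_sq_le_sq (by positivity) ((E.norm_innerR_mul_self_le x y).trans_eq ?_)
  rw [E.norm_innerR_self, E.norm_innerL_self]
  ring

theorem norm_innerL_le (x y : Z) : ‖E.innerL x y‖ ≤ ‖x‖ * ‖y‖ := by
  refine nonneg_le_nonneg_of_sq_le_sq (by positivity) ((E.norm_innerL_mul_self_le x y).trans_eq ?_)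
  rw [E.norm_innerR_self, E.norm_innerL_self]
  ring

include E in
theorem norm_act_left_le (a : A) (z : Z) : ‖a • z‖ ≤ ‖a‖ * ‖z‖ := by
  refine nonneg_le_nonneg_of_sq_le_sq (by positivity) ?_
  rw [← E.norm_innerR_self, E.innerR_act_left, ← mul_smul]
  refine (E.norm_innerR_smul_self_le (star_mul_self_nonneg a) z).trans_eq ?_
  rw [CStarRing.norm_star_mul_self, E.norm_innerR_self]
  ring

include E in
theorem norm_act_right_le (z : Z) (b : B) : ‖z <• b‖ ≤ ‖z‖ * ‖b‖ := by
  refine nonneg_le_nonneg_of_sq_le_sq (by positivity) ?_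
  rw [← E.norm_innerR_self, E.innerR_act_right, E.innerR_act_right_left]
  refine (norm_mul_le _ _).trans ((mul_le_mul_of_nonneg_right (norm_mul_le _ _)
    (norm_nonneg _)).trans_eq ?_)
  rw [E.norm_innerR_self, norm_star]
  ring

end ImprimitivityBimodule

theorem exists_eq_star_mul_self_of_nonneg {C : Type*} [NonUnitalCStarAlgebra C] [PartialOrder C]
    [StarOrderedRing C] {a : C} (ha : 0 ≤ a) : ∃ b, a = star b * b :=
  CStarAlgebra.nonneg_iff_eq_star_mul_self.1 ha

/-! ### Positive matrices over a C⋆-algebra. -/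

section CStarMatrix

variable {C : Type*} [CStarAlgebra C] [PartialOrder C] [StarOrderedRing C]

theorem CStarMatrix.ofMatrix_sum_nonneg {n : ℕ} {κ : Type*} (s : Finset κ)
    (M : κ → Matrix (Fin n) (Fin n) C) (h : ∀ k, 0 ≤ CStarMatrix.ofMatrix (M k)) :
    0 ≤ CStarMatrix.ofMatrix (Matrix.of fun i j => ∑ k ∈ s, M k i j) := by
  have hs := Finset.sum_nonneg fun k (_ : k ∈ s) => h k
  convert hs using 1
  ext i j
  exact (Matrix.sum_apply i j s M).symm

theorem CStarMatrix.ofMatrix_star_mul_nonneg {n : ℕ} (v : Fin n → C) :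
    0 ≤ CStarMatrix.ofMatrix (Matrix.of fun i j => star (v i) * v j) := by
  cases n with
  | zero =>
    have h : CStarMatrix.ofMatrix (Matrix.of fun i j : Fin 0 => star (v i) * v j) = 0 :=
      CStarMatrix.ext fun i => i.elim0
    exact h.ge
  | succ n =>
    -- The row `v` padded with zeros to a square matrix; this needs an index `0`, hence the case
    -- split.
    let R : CStarMatrix (Fin (n + 1)) (Fin (n + 1)) C :=
      CStarMatrix.ofMatrix (Matrix.of fun i j => if i = 0 then v j else 0)
    convert star_mul_self_nonneg R using 1
    ext i j
    rw [CStarMatrix.mul_apply, Finset.sum_eq_single 0]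
    · simp [R, CStarMatrix.star_apply]
    · intro k _ hk
      simp [R, hk]
    · simp

end CStarMatrix

/-! ### Compressions and coefficient maps. -/

namespace ImprimitivityBimodule

variable {A B Z : Type*}
    [CStarAlgebra A] [PartialOrder A] [StarOrderedRing A]
    [CStarAlgebra B] [PartialOrder B] [StarOrderedRing B]
    [NormedAddCommGroup Z] [NormedSpace ℂ Z] [CompleteSpace Z]
    [Module A Z] [IsScalarTower ℂ A Z] [Module Bᵐᵒᵖ Z] [IsScalarTower ℂ Bᵐᵒᵖ Z]
    (E : ImprimitivityBimodule A B Z)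

/-- Inserting `1 = ∑ _A⟨y_k, y_k⟩` splits the Gram matrix into a sum of matrices `v_p⋆ v_q` over
`B`. -/
theorem gram_nonneg {n : ℕ} (η : Fin n → Z) :
    0 ≤ CStarMatrix.ofMatrix (Matrix.of fun p q => E.innerR (η p) (η q)) := by
  obtain ⟨m, y, hy⟩ := E.exists_sum_innerL_eq_one
  have key : ∀ p q, E.innerR (η p) (η q) =
      ∑ k, star (E.innerR (y k) (η p)) * E.innerR (y k) (η q) := fun p q => by
    conv_lhs => rw [← one_smul A (η q), ← hy, Finset.sum_smul, E.positiveForm_innerR.sum_right]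
    simp only [E.innerL_smul_eq, E.innerR_act_right, E.star_innerR]
  simp only [key]
  exact CStarMatrix.ofMatrix_sum_nonneg Finset.univ
    (fun k => Matrix.of fun p q => star (E.innerR (y k) (η p)) * E.innerR (y k) (η q))
    fun k => CStarMatrix.ofMatrix_star_mul_nonneg fun p => E.innerR (y k) (η p)

/-- Block compression of a positive matrix over `A` along a family of vectors of `Z`. -/
theorem compression_nonneg {N n m : ℕ} (e : Fin n × Fin m → Fin N)
    {M : CStarMatrix (Fin N) (Fin N) A} (hM : 0 ≤ M) (ξ : Fin N → Z) :
    0 ≤ CStarMatrix.ofMatrix (Matrix.of fun p q : Fin n => ∑ i, ∑ j,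
      E.innerR (ξ (e (p, i))) (M (e (p, i)) (e (q, j)) • ξ (e (q, j)))) := by
  obtain ⟨R, rfl⟩ := exists_eq_star_mul_self_of_nonneg hM
  -- With `M = R⋆R`, each row of `R` contributes a Gram matrix.
  have key : ∀ p q : Fin n, ∑ i, ∑ j,
      E.innerR (ξ (e (p, i))) ((star R * R) (e (p, i)) (e (q, j)) • ξ (e (q, j))) =
      ∑ r, E.innerR (∑ i, R r (e (p, i)) • ξ (e (p, i)))
        (∑ j, R r (e (q, j)) • ξ (e (q, j))) := fun p q => by
    simp only [E.positiveForm_innerR.sum_left, E.positiveForm_innerR.sum_right,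
      CStarMatrix.mul_apply, CStarMatrix.star_apply, Finset.sum_smul, mul_smul, E.innerR_act_left]
    rw [Finset.sum_congr rfl fun i _ => Finset.sum_comm, Finset.sum_comm]
  simp only [key]
  exact CStarMatrix.ofMatrix_sum_nonneg Finset.univ _ fun r => E.gram_nonneg _

/-- The linear map `b ↦ ⟨x, φ(_A⟨x b, y⟩) y⟩_B`. -/
noncomputable def coeff (x y : Z) (φ : A →ₗ[ℂ] A) : B →ₗ[ℂ] B where
  toFun b := E.innerR x (φ (E.innerL (x <• b) y) • y)
  map_add' b c := by
    rw [MulOpposite.op_add, add_smul, E.innerL_add_left, map_add, add_smul, E.innerR_add_right]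
  map_smul' c b := by
    rw [MulOpposite.op_smul, smul_assoc, E.innerL_smul_left, map_smul, smul_assoc,
      E.innerR_smul_right, RingHom.id_apply]

theorem coeff_apply (x y : Z) (φ : A →ₗ[ℂ] A) (b : B) :
    E.coeff x y φ b = E.innerR x (φ (E.innerL (x <• b) y) • y) := rfl

theorem coeff_zero (x y : Z) : E.coeff x y (0 : A →ₗ[ℂ] A) = 0 := by
  ext b
  rw [coeff_apply, LinearMap.zero_apply, zero_smul, LinearMap.zero_apply]
  exact map_zero (E.positiveForm_innerR.right x)

theorem norm_coeff_le (x y : Z) (φ : A →ₗ[ℂ] A) {c : ℝ} (hc : 0 ≤ c)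
    (hφ : ∀ a, ‖φ a‖ ≤ c * ‖a‖) (b : B) :
    ‖E.coeff x y φ b‖ ≤ c * (‖x‖ * ‖y‖) ^ 2 * ‖b‖ := by
  calc ‖E.coeff x y φ b‖ ≤ ‖x‖ * ‖φ (E.innerL (x <• b) y) • y‖ := E.norm_innerR_le _ _
    _ ≤ ‖x‖ * (‖φ (E.innerL (x <• b) y)‖ * ‖y‖) := by gcongr; exact E.norm_act_left_le _ _
    _ ≤ ‖x‖ * (c * ‖E.innerL (x <• b) y‖ * ‖y‖) := by gcongr; exact hφ _
    _ ≤ ‖x‖ * (c * (‖x <• b‖ * ‖y‖) * ‖y‖) := by gcongr; exact E.norm_innerL_le _ _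
    _ ≤ ‖x‖ * (c * ((‖x‖ * ‖b‖) * ‖y‖) * ‖y‖) := by gcongr; exact E.norm_act_right_le _ _
    _ = _ := by ring

theorem coeff_id_apply (x y : Z) (b : B) :
    E.coeff x y LinearMap.id b = E.innerR x x * b * E.innerR y y := by
  rw [coeff_apply, LinearMap.id_apply, E.innerL_smul_eq, E.innerR_act_right, E.innerR_act_right]

theorem tendsto_coeff {I : Type*} {l : Filter I} (x y : Z) {φ : I → A →ₗ[ℂ] A}
    (hφ : ∀ a, Tendsto (fun i => φ i a) l (𝓝 a)) (b : B) :
    Tendsto (fun i => E.coeff x y (φ i) b) l (𝓝 (E.innerR x x * b * E.innerR y y)) := by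
  rw [← E.coeff_id_apply, tendsto_iff_norm_sub_tendsto_zero]
  have h := (tendsto_iff_norm_sub_tendsto_zero.1 (hφ (E.innerL (x <• b) y))).const_mul ‖x‖
    |>.mul_const ‖y‖
  rw [mul_zero, zero_mul] at h
  refine squeeze_zero (fun _ => norm_nonneg _) (fun i => ?_) h
  rw [coeff_apply, coeff_apply, ← E.positiveForm_innerR.sub_right, ← sub_smul, mul_assoc]
  exact (E.norm_innerR_le _ _).trans
    (mul_le_mul_of_nonneg_left (E.norm_act_left_le _ _) (norm_nonneg _))

end ImprimitivityBimodule

/-! ### Transport along the compatible action. -/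

namespace CompatibleAction

variable {A B G Z : Type*}
    [CStarAlgebra A] [PartialOrder A] [StarOrderedRing A]
    [CStarAlgebra B] [PartialOrder B] [StarOrderedRing B] [Group G]
    [NormedAddCommGroup Z] [NormedSpace ℂ Z] [CompleteSpace Z]
    [Module A Z] [IsScalarTower ℂ A Z] [Module Bᵐᵒᵖ Z] [IsScalarTower ℂ Bᵐᵒᵖ Z]
    {S : TwistedSystem A G} {T : TwistedSystem B G} {E : ImprimitivityBimodule A B Z}
    (δ : CompatibleAction S T E.toRightHilbertBimodule)

/-- Compatibility is assumed for the `B`-valued product only; the `A`-valued one follows because `A`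
acts faithfully. -/
theorem innerL_δ (g : G) (x y : Z) : E.innerL (δ.δ g x) (δ.δ g y) = S.α g (E.innerL x y) := by
  refine E.eq_of_smul_eq fun z => ?_
  obtain ⟨w, rfl⟩ := (δ.δ g).surjective z
  rw [E.innerL_smul_eq, δ.innerR_δ, ← δ.δ_act_right, ← E.innerL_smul_eq, δ.δ_act_left]

theorem norm_δ (g : G) (x : Z) : ‖δ.δ g x‖ = ‖x‖ := by
  rw [E.norm_eq_sqrt_innerR, E.norm_eq_sqrt_innerR, δ.innerR_δ, StarAlgEquiv.norm_map]

theorem innerL_symm_act (g h : G) (x y : Z) (b : B) :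
    E.innerL (x <• (T.α g).symm (b * star (T.σ g h : B))) (δ.δ h y) =
      (S.α g).symm (E.innerL (δ.δ g x <• b) (δ.δ (g * h) y) * star (S.σ g h : A)) := by
  apply EquivLike.injective (S.α g)
  rw [← δ.innerL_δ, δ.δ_act_right, δ.δ_comp, StarAlgEquiv.apply_symm_apply,
    StarAlgEquiv.apply_symm_apply, ← E.innerL_act_right, MulOpposite.op_mul, mul_smul,
    ← mul_smul (MulOpposite.op (T.σ g h : B)), ← MulOpposite.op_mul,
    E.innerL_act_left_right]
  simp

/-- Expanding `δ(g)δ(h)y` cancels both factors of `θ` and produces exactly the factors of `σ`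
required by positive definiteness over `A`. -/
theorem α_coeff (g h : G) (x y : Z) (φ : A →ₗ[ℂ] A) (b : B) :
    T.α g (E.coeff x (δ.δ h y) φ ((T.α g).symm (b * star (T.σ g h : B)))) * (T.σ g h : B) =
      E.innerR (δ.δ g x) ((S.α g (φ ((S.α g).symm
        (E.innerL (δ.δ g x <• b) (δ.δ (g * h) y) * star (S.σ g h : A)))) * (S.σ g h : A)) •
          δ.δ (g * h) y) := by
  rw [E.coeff_apply, δ.innerL_symm_act, ← δ.innerR_δ, δ.δ_act_left, δ.δ_comp,
    ← E.smul_act_comm, E.innerR_act_right, mul_assoc, mul_smul]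
  simp

/-- Transport of a family of linear maps on `A` to a family of linear maps on `B`, by means of a
finite family of vectors of the bimodule. -/
noncomputable def transport {m : ℕ} (x : Fin m → Z) (φ : G → (A →ₗ[ℂ] A)) (g : G) : B →ₗ[ℂ] B :=
  ∑ i, ∑ j, E.coeff (x i) (δ.δ g (x j)) (φ g)

theorem transport_apply {m : ℕ} (x : Fin m → Z) (φ : G → (A →ₗ[ℂ] A)) (g : G) (b : B) :
    δ.transport x φ g b = ∑ i, ∑ j, E.coeff (x i) (δ.δ g (x j)) (φ g) b := by
  simp only [transport, LinearMap.sum_apply]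

theorem transport_eq_zero {m : ℕ} (x : Fin m → Z) {φ : G → (A →ₗ[ℂ] A)} {g : G} (h : φ g = 0) :
    δ.transport x φ g = 0 := by
  simp only [transport, h, E.coeff_zero, Finset.sum_const_zero]

theorem norm_transport_le {m : ℕ} (x : Fin m → Z) {φ : G → (A →ₗ[ℂ] A)} {c : ℝ} (hc : 0 ≤ c)
    (hφ : ∀ g a, ‖φ g a‖ ≤ c * ‖a‖) (g : G) (b : B) :
    ‖δ.transport x φ g b‖ ≤ (∑ i, ∑ j, c * (‖x i‖ * ‖x j‖) ^ 2) * ‖b‖ := by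
  rw [transport_apply]
  simp only [Finset.sum_mul]
  refine norm_sum_le_of_le _ fun i _ => norm_sum_le_of_le _ fun j _ => ?_
  simpa only [δ.norm_δ] using E.norm_coeff_le (x i) (δ.δ g (x j)) (φ g) hc (hφ g) b

theorem tendsto_transport {I : Type*} {l : Filter I} {m : ℕ} {x : Fin m → Z}
    (hx : ∑ i, E.innerR (x i) (x i) = 1) {φ : I → G → (A →ₗ[ℂ] A)}
    (hφ : ∀ g a, Tendsto (fun i => φ i g a) l (𝓝 a)) (g : G) (b : B) :
    Tendsto (fun i => δ.transport x (φ i) g b) l (𝓝 b) := by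
  -- `δ(g)` carries the frame to a frame, since `β_g` is unital.
  have h : b = ∑ i, ∑ j,
      E.innerR (x i) (x i) * b * E.innerR (δ.δ g (x j)) (δ.δ g (x j)) := by
    simp only [← Finset.mul_sum, ← Finset.sum_mul, δ.innerR_δ, ← map_sum, hx, map_one, one_mul,
      mul_one]
  simp only [transport_apply]
  conv => enter [3, 1]; rw [h]
  exact tendsto_finsetSum _ fun i _ => tendsto_finsetSum _ fun j _ =>
    E.tendsto_coeff (x i) (δ.δ g (x j)) (hφ g) b

/-- Expanding `u b⋆` in the frame yields sums of products `a_s⋆ a_t`, the shape required by positive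
definiteness. -/
theorem innerL_act_star_mul {m : ℕ} {x : Fin m → Z} (hx : ∑ i, E.innerR (x i) (x i) = 1)
    (u v : Z) (b c : B) :
    E.innerL (u <• (star b * c)) v =
      ∑ k, star (E.innerL (x k) (u <• star b)) * E.innerL (x k) (v <• star c) := by
  have h : u <• star b = ∑ k, E.innerL (u <• star b) (x k) • x k := by
    simp only [E.innerL_smul_eq, ← Finset.sum_smul, ← Finset.op_sum, hx, MulOpposite.op_one,
      one_smul]
  rw [MulOpposite.op_mul, mul_smul, E.innerL_act_right]
  conv_lhs => rw [h]
  rw [E.positiveForm_innerL.sum_right]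
  simp only [E.innerL_act_left, E.star_innerL]

theorem isPositiveDefinite_transport {m : ℕ} {x : Fin m → Z}
    (hx : ∑ i, E.innerR (x i) (x i) = 1) {φ : G → (A →ₗ[ℂ] A)} (hφ : S.IsPositiveDefinite φ) :
    T.IsPositiveDefinite (δ.transport x φ) := by
  intro n g b
  let e : Fin n × Fin m ≃ Fin (n * m) := finProdFinEquiv
  let γ : Fin (n * m) → G := fun s => g (e.symm s).1
  let ξ : Fin (n * m) → Z := fun s => δ.δ (γ s) (x (e.symm s).2)
  -- Here `s` encodes a pair `(p, i)`; each `k` gives one positive matrix of size `n * m`,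
  -- compressed to size `n`.
  let a : Fin m → Fin (n * m) → A := fun k s =>
    E.innerL (x k) (ξ s <• star (b (e.symm s).1))
  have h := CStarMatrix.ofMatrix_sum_nonneg Finset.univ _ fun k : Fin m =>
    E.compression_nonneg e (hφ (n * m) γ (a k)) ξ
  convert h using 1
  ext p q
  simp only [CStarMatrix.ofMatrix_apply, Matrix.of_apply, transport_apply, map_sum, Finset.sum_mul,
    δ.α_coeff, γ, ξ, a, Equiv.symm_apply_apply, innerL_act_star_mul hx, mul_inv_cancel_left,
    Finset.sum_smul, E.positiveForm_innerR.sum_right]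
  rw [Finset.sum_congr rfl fun i _ => Finset.sum_comm, Finset.sum_comm]

end CompatibleAction

/-! ### Reindexing of nets and conclusion. -/

/-- Amenability can be tested one finite set and one tolerance at a time. -/
theorem TwistedSystem.isAmenable_of_forall_finset {A G : Type*} [CStarAlgebra A] [PartialOrder A]
    [StarOrderedRing A] [Group G] (S : TwistedSystem A G) (C : ℝ)
    (h : ∀ (F : Finset (G × A)) (ε : ℝ), 0 < ε → ∃ φ : G → (A →ₗ[ℂ] A), S.IsPositiveDefinite φ ∧
      {g : G | φ g ≠ 0}.Finite ∧ (∀ g a, ‖φ g a‖ ≤ C * ‖a‖) ∧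
      ∀ p ∈ F, ‖φ p.1 p.2 - p.2‖ < ε) : S.IsAmenable := by
  classical
  choose φ hpos hfin hbd hlim using
    fun i : Finset (G × A) × ℕ => h i.1 (1 / (i.2 + 1)) Nat.one_div_pos_of_nat
  refine ⟨Finset (G × A) × ℕ, inferInstance, inferInstance, inferInstance, φ, hpos, hfin,
    ⟨C, hbd⟩, fun g a => ?_⟩
  rw [Metric.tendsto_atTop]
  intro ε hε
  obtain ⟨n, hn⟩ := exists_nat_one_div_lt hε
  refine ⟨({(g, a)}, n), fun i hi => ?_⟩
  rw [Real.dist_0_eq_abs, abs_norm]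
  refine (hlim i (g, a) (hi.1 (Finset.mem_singleton_self _))).trans_le (le_trans ?_ hn.le)
  exact Nat.one_div_le_one_div hi.2

theorem mainTheorem1 {A B G Z : Type*}
    [CStarAlgebra A] [PartialOrder A] [StarOrderedRing A]
    [CStarAlgebra B] [PartialOrder B] [StarOrderedRing B] [Group G]
    [NormedAddCommGroup Z] [NormedSpace ℂ Z] [CompleteSpace Z]
    [Module A Z] [IsScalarTower ℂ A Z] [Module Bᵐᵒᵖ Z] [IsScalarTower ℂ Bᵐᵒᵖ Z]
    (S : TwistedSystem A G) (T : TwistedSystem B G)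
    (E : ImprimitivityBimodule A B Z)
    (δ : CompatibleAction S T E.toRightHilbertBimodule)
    (hS : S.IsAmenable) : T.IsAmenable := by
  obtain ⟨I, _, _, _, φ, hpos, hfin, ⟨C, hC⟩, hlim⟩ := hS
  obtain ⟨m, x, hx⟩ := E.exists_sum_innerR_eq_one
  -- `C` may be negative when `A` is trivial.
  have hC' : ∀ i g a, ‖φ i g a‖ ≤ max C 0 * ‖a‖ := fun i g a =>
    (hC i g a).trans (mul_le_mul_of_nonneg_right (le_max_left _ _) (norm_nonneg _))
  -- `I` lies in the universe of `G × A`, so the net is reindexed over `G × B`.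
  refine T.isAmenable_of_forall_finset (∑ i, ∑ j, max C 0 * (‖x i‖ * ‖x j‖) ^ 2)
    fun F ε hε => ?_
  have hev : ∀ᶠ i in atTop, ∀ p ∈ F, ‖δ.transport x (φ i) p.1 p.2 - p.2‖ < ε := by
    rw [Filter.eventually_all_finset]
    intro p _
    have h := δ.tendsto_transport hx
      (fun g a => tendsto_iff_norm_sub_tendsto_zero.2 (hlim g a)) p.1 p.2
    exact (tendsto_iff_norm_sub_tendsto_zero.1 h).eventually_lt_const hε
  obtain ⟨i, hi⟩ := hev.exists
  exact ⟨δ.transport x (φ i), δ.isPositiveDefinite_transport hx (hpos i),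
    (hfin i).subset fun g hg h => hg (δ.transport_eq_zero x h),
    δ.norm_transport_le x (le_max_right _ _) (hC' i), hi⟩
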